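/- Let $(X,\mathcal B,\mu)$ be a standard non-atomic probability space, and let $\mathrm{Aut}$ be the group of invertible $\mu$-preserving transformations of $X$, where transformations that differ on a set of measure $0$ are identified. Equip $\mathrm{Aut}$ with the Halmos metric $$\rho(S,T)=\sum_{i=1}^\infty 2^{-i}\bigl(\mu(SA_i\,\Delta\, TA_i)+\mu(S^{-1}A_i\,\Delta\, T^{-1}A_i)\bigr),$$ where $\{A_i\}_{i\ge 1}$ is a fixed sequence of measurable sets that is dense in $\mathcal B$ with respect to the distance $\mu(B\,\Delta\, C)$. For a finite measurable partition $\xi=\{C_1,\dots,C_n\}$ put $H(\xi)=-\sum_{i=1}^n\mu(C_i)\ln\mu(C_i)$ (with $0\ln 0=0$). Let $L(j)$, $j\ge 1$, be a sequence of non-negative integers with $L(j)\to\infty$, and let $P_j=\{j,2j,\dots,L(j)j\}$. For $S\in\mathrm{Aut}$ define $$h_P(S)=\sup_\xi\ \limsup_{j\to\infty}\ \frac1{|P_j|}\,H\Bigl(\bigvee_{p\in P_j}S^p\xi\Bigr)\in[0,\infty],$$ where the supremum is over all finite measurable partitions $\xi$ of $X$. Theorem. The set $\{S\in\mathrm{Aut}:\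 h_P(S)=\infty\}$ is typical in $(\mathrm{Aut},\rho)$, i.e. its complement is a set of the first category (a countable union of nowhere dense sets). -/

import Mathlib

open MeasureTheory Filter Topology
open scoped symmDiff

noncomputable section

namespace PEntropy

variable {X : Type*} [MeasurableSpace X]

/-- Bijections of `X` that are measurable and `μ`-preserving in both directions. -/
def MPPerm (μ : Measure X) : Subgroup (Equiv.Perm X) where
  carrier := {e | MeasurePreserving (⇑e) μ μ ∧ MeasurePreserving (⇑e⁻¹) μ μ}
  one_mem' := ⟨MeasurePreserving.id μ, MeasurePreserving.id μ⟩
  mul_mem' := fun {a b} ha hb => by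
    refine ⟨ha.1.comp hb.1, ?_⟩
    rw [mul_inv_rev]
    exact hb.2.comp ha.2
  inv_mem' := fun {a} ha => ⟨ha.2, by rw [inv_inv]; exact ha.1⟩

/-- Identification of transformations that differ on a set of measure zero. -/
def aeCon (μ : Measure X) : Con (MPPerm μ) where
  r S T := ⇑S.1 =ᵐ[μ] ⇑T.1
  iseqv := ⟨fun _ => EventuallyEq.rfl, fun h => h.symm, fun h h' => h.trans h'⟩
  mul' := fun {a b c d} hab hcd => by
    have h1 : ⇑a.1 ∘ ⇑c.1 =ᵐ[μ] ⇑b.1 ∘ ⇑c.1 := c.2.1.quasiMeasurePreserving.ae_eq_comp hab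
    have h2 : ⇑b.1 ∘ ⇑c.1 =ᵐ[μ] ⇑b.1 ∘ ⇑d.1 := hcd.fun_comp _
    exact h1.trans h2

/-- The group `Aut` of automorphisms of the measure space `(X, μ)`, modulo null sets. -/
abbrev Aut (μ : Measure X) : Type _ := (aeCon μ).Quotient

/-- `A 0, A 1, …` is a sequence of measurable sets that is dense in the algebra of measurable sets
for the distance `μ (B ∆ C)`. -/
def IsDenseFamily (μ : Measure X) (A : ℕ → Set X) : Prop :=
  (∀ i, MeasurableSet (A i)) ∧
    ∀ B, MeasurableSet B → ∀ ε : ℝ, 0 < ε → ∃ i, μ.real (A i ∆ B) < ε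

/-- `μ (S B ∆ T B) + μ (S⁻¹ B ∆ T⁻¹ B)`. -/
def halmosTerm (μ : Measure X) (B : Set X) (S T : MPPerm μ) : ℝ :=
  μ.real ((⇑S.1 '' B) ∆ (⇑T.1 '' B)) + μ.real ((⇑(S⁻¹).1 '' B) ∆ (⇑(T⁻¹).1 '' B))

/-- The Halmos distance `∑ᵢ 2⁻ⁱ [μ (S Aᵢ ∆ T Aᵢ) + μ (S⁻¹ Aᵢ ∆ T⁻¹ Aᵢ)]`, with `A i` in the role of
`A_{i+1}`. -/
def halmosDist (μ : Measure X) (A : ℕ → Set X) (S T : MPPerm μ) : ℝ :=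
  ∑' i : ℕ, (1 / 2 : ℝ) ^ (i + 1) * halmosTerm μ (A i) S T

theorem image_eq_preimage_inv {μ : Measure X} (S : MPPerm μ) (B : Set X) :
    ⇑S.1 '' B = ⇑(S⁻¹).1 ⁻¹' B :=
  Equiv.image_eq_preimage_symm S.1 B

theorem image_inv_eq_preimage {μ : Measure X} (S : MPPerm μ) (B : Set X) :
    ⇑(S⁻¹).1 '' B = ⇑S.1 ⁻¹' B := by
  rw [image_eq_preimage_inv, inv_inv]

theorem aeCon_inv {μ : Measure X} {S T : MPPerm μ} (h : aeCon μ S T) :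
    ⇑(S⁻¹).1 =ᵐ[μ] ⇑(T⁻¹).1 := (aeCon μ).inv h

theorem halmosTerm_congr {μ : Measure X} (B : Set X) {S T S' T' : MPPerm μ}
    (hS : aeCon μ S S') (hT : aeCon μ T T') : halmosTerm μ B S T = halmosTerm μ B S' T' := by
  simp only [halmosTerm, image_eq_preimage_inv, inv_inv]
  have e1 : ⇑S.1 ⁻¹' B =ᵐ[μ] ⇑S'.1 ⁻¹' B := EventuallyEq.preimage hS B
  have e2 : ⇑T.1 ⁻¹' B =ᵐ[μ] ⇑T'.1 ⁻¹' B := EventuallyEq.preimage hT B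
  have e3 : ⇑(S⁻¹).1 ⁻¹' B =ᵐ[μ] ⇑(S'⁻¹).1 ⁻¹' B := EventuallyEq.preimage (aeCon_inv hS) B
  have e4 : ⇑(T⁻¹).1 ⁻¹' B =ᵐ[μ] ⇑(T'⁻¹).1 ⁻¹' B := EventuallyEq.preimage (aeCon_inv hT) B
  rw [measureReal_congr (e1.symmDiff e2), measureReal_congr (e3.symmDiff e4)]

theorem halmosTerm_nonneg {μ : Measure X} (B : Set X) (S T : MPPerm μ) :
    0 ≤ halmosTerm μ B S T := add_nonneg measureReal_nonneg measureReal_nonneg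

theorem halmosTerm_le {μ : Measure X} [IsProbabilityMeasure μ] (B : Set X) (S T : MPPerm μ) :
    halmosTerm μ B S T ≤ 2 := by
  have h1 : μ.real ((⇑S.1 '' B) ∆ (⇑T.1 '' B)) ≤ 1 := measureReal_le_one
  have h2 : μ.real ((⇑(S⁻¹).1 '' B) ∆ (⇑(T⁻¹).1 '' B)) ≤ 1 := measureReal_le_one
  unfold halmosTerm
  linarith

theorem halmosTerm_triangle {μ : Measure X} [IsProbabilityMeasure μ] (B : Set X)
    (S T R : MPPerm μ) : halmosTerm μ B S R ≤ halmosTerm μ B S T + halmosTerm μ B T R := by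
  have h1 := measureReal_symmDiff_le (μ := μ) (s := ⇑S.1 '' B) (t := ⇑T.1 '' B) (⇑R.1 '' B)
  have h2 := measureReal_symmDiff_le (μ := μ) (s := ⇑(S⁻¹).1 '' B) (t := ⇑(T⁻¹).1 '' B)
    (⇑(R⁻¹).1 '' B)
  unfold halmosTerm
  linarith

theorem halmos_summable {μ : Measure X} [IsProbabilityMeasure μ] (A : ℕ → Set X)
    (S T : MPPerm μ) : Summable fun i : ℕ => (1 / 2 : ℝ) ^ (i + 1) * halmosTerm μ (A i) S T := by
  have hg : Summable fun i : ℕ => (1 / 2 : ℝ) ^ i := summable_geometric_two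
  refine Summable.of_nonneg_of_le
    (fun i => mul_nonneg (by positivity) (halmosTerm_nonneg _ _ _)) (fun i => ?_) hg
  calc (1 / 2 : ℝ) ^ (i + 1) * halmosTerm μ (A i) S T
      ≤ (1 / 2 : ℝ) ^ (i + 1) * 2 :=
        mul_le_mul_of_nonneg_left (halmosTerm_le _ _ _) (by positivity)
    _ = (1 / 2 : ℝ) ^ i := by ring

theorem aeCon_of_halmosDist_eq_zero {μ : Measure X} [IsProbabilityMeasure μ]
    [StandardBorelSpace X] {A : ℕ → Set X} (hA : IsDenseFamily μ A) {S T : MPPerm μ}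
    (h : halmosDist μ A S T = 0) : aeCon μ S T := by
  have hz : ∀ i, halmosTerm μ (A i) S T = 0 := by
    have h0 := (halmos_summable A S T).hasSum
    rw [show (∑' i : ℕ, (1 / 2 : ℝ) ^ (i + 1) * halmosTerm μ (A i) S T) = 0 from h] at h0
    have h1 := (hasSum_zero_iff_of_nonneg
      (fun i => mul_nonneg (by positivity) (halmosTerm_nonneg _ _ _))).1 h0
    intro i
    have h2 := congrFun h1 i
    have h3 : ((1 / 2 : ℝ) ^ (i + 1)) ≠ 0 := by positivity
    simpa [h3] using h2
  have hz' : ∀ i, μ.real ((⇑S.1 ⁻¹' A i) ∆ (⇑T.1 ⁻¹' A i)) = 0 := by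
    intro i
    have h1 := hz i
    simp only [halmosTerm, image_inv_eq_preimage] at h1
    linarith [measureReal_nonneg (μ := μ) (s := (⇑S.1 ⁻¹' A i) ∆ (⇑T.1 ⁻¹' A i)),
      measureReal_nonneg (μ := μ) (s := (⇑S.1 '' A i) ∆ (⇑T.1 '' A i))]
  refine EventuallyEq.of_forall_separating_preimage MeasurableSet fun B hB => ?_
  rw [← measure_symmDiff_eq_zero_iff, ← measureReal_eq_zero_iff]
  refine le_antisymm (le_of_forall_pos_le_add fun ε hε => ?_) measureReal_nonneg
  obtain ⟨i, hi⟩ := hA.2 B hB (ε / 2) (by positivity)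
  have hm : MeasurableSet (A i ∆ B) := (hA.1 i).symmDiff hB
  have hS : μ.real ((⇑S.1 ⁻¹' A i) ∆ (⇑S.1 ⁻¹' B)) = μ.real (A i ∆ B) := by
    rw [← Set.preimage_symmDiff]
    exact S.2.1.measureReal_preimage hm.nullMeasurableSet
  have hT : μ.real ((⇑T.1 ⁻¹' A i) ∆ (⇑T.1 ⁻¹' B)) = μ.real (A i ∆ B) := by
    rw [← Set.preimage_symmDiff]
    exact T.2.1.measureReal_preimage hm.nullMeasurableSet
  have t1 := measureReal_symmDiff_le (μ := μ) (s := ⇑S.1 ⁻¹' B) (t := ⇑S.1 ⁻¹' A i) (⇑T.1 ⁻¹' B)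
  have t2 := measureReal_symmDiff_le (μ := μ) (s := ⇑S.1 ⁻¹' A i) (t := ⇑T.1 ⁻¹' A i)
    (⇑T.1 ⁻¹' B)
  rw [symmDiff_comm (⇑S.1 ⁻¹' B) (⇑S.1 ⁻¹' A i)] at t1
  linarith [hz' i]

/-- The Halmos metric on `Aut` given by a dense family of sets. -/
@[reducible]
def halmosMetric (μ : Measure X) [IsProbabilityMeasure μ] [StandardBorelSpace X]
    {A : ℕ → Set X} (hA : IsDenseFamily μ A) : MetricSpace (Aut μ) where
  dist S T := Con.liftOn₂ S T (halmosDist μ A) fun S T S' T' hS hT => by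
    simp only [halmosDist, halmosTerm_congr _ hS hT]
  dist_self S := by
    induction S using Con.induction_on with | _ S
    change halmosDist μ A S S = 0
    simp [halmosDist, halmosTerm]
  dist_comm S T := by
    induction S using Con.induction_on with | _ S
    induction T using Con.induction_on with | _ T
    change halmosDist μ A S T = halmosDist μ A T S
    simp only [halmosDist, halmosTerm, symmDiff_comm]
  dist_triangle S T R := by
    induction S using Con.induction_on with | _ S
    induction T using Con.induction_on with | _ T
    induction R using Con.induction_on with | _ R
    change halmosDist μ A S R ≤ halmosDist μ A S T + halmosDist μ A T R
    unfold halmosDist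
    rw [← (halmos_summable A S T).tsum_add (halmos_summable A T R)]
    refine (halmos_summable A S R).tsum_le_tsum (fun i => ?_)
      ((halmos_summable A S T).add (halmos_summable A T R))
    rw [← mul_add]
    exact mul_le_mul_of_nonneg_left (halmosTerm_triangle _ _ _ _) (by positivity)
  eq_of_dist_eq_zero {S T} h := by
    induction S using Con.induction_on with | _ S
    induction T using Con.induction_on with | _ T
    exact (Con.eq _).2 (aeCon_of_halmosDist_eq_zero hA h)

/-- A set is typical if its complement is of the first category. -/
def IsTypical {Y : Type*} [TopologicalSpace Y] (s : Set Y) : Prop := IsMeagre sᶜ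

/-- Entropy `-∑ μ (C) ln μ (C)` of the finite partition into the fibres `C` of a map `η`.
Finite measurable partitions are encoded by measurable maps to a finite set; some fibres may be
empty, and these contribute `0`. -/
def partEntropy (μ : Measure X) {ι : Type*} [Fintype ι] (η : X → ι) : ℝ :=
  ∑ i, Real.negMulLog (μ.real (η ⁻¹' {i}))

/-- The join `⋁_{p ∈ F} Sᵖ ξ`: the point `x` lies in the cell of `Sᵖ ξ` that is the image under
`Sᵖ` of the cell of `ξ` with label `ξ (S⁻ᵖ x)`. -/
def joinPartition {μ : Measure X} (S : MPPerm μ) (F : Finset ℤ) {k : ℕ} (ξ : X → Fin k) :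
    X → (F → Fin k) :=
  fun x p => ξ (((S ^ (p : ℤ))⁻¹).1 x)

/-- `H (⋁_{p ∈ F} Sᵖ ξ)` for `S ∈ Aut`. -/
def joinEntropy {μ : Measure X} (S : Aut μ) (F : Finset ℤ) {k : ℕ} (ξ : X → Fin k) : ℝ :=
  Con.liftOn S (fun S => partEntropy μ (joinPartition S F ξ)) fun S T h => by
    have key : joinPartition S F ξ =ᵐ[μ] joinPartition T F ξ := by
      have h1 : ∀ p : F, ∀ᵐ x ∂μ, ((S ^ (p : ℤ))⁻¹).1 x = ((T ^ (p : ℤ))⁻¹).1 x :=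
        fun p => (aeCon μ).inv ((aeCon μ).zpow (p : ℤ) h)
      filter_upwards [ae_all_iff.2 h1] with x hx
      funext p
      simp only [joinPartition, hx p]
    unfold partEntropy
    exact Finset.sum_congr rfl fun i _ => by rw [measureReal_congr (key.preimage {i})]

/-- `h_P (S) = sup_ξ limsup_j |P_j|⁻¹ H (⋁_{p ∈ P_j} Sᵖ ξ)`, the supremum being over all finite
measurable partitions `ξ`. -/
def pEntropy {μ : Measure X} (P : ℕ → Finset ℤ) (S : Aut μ) : EReal :=
  ⨆ (k : ℕ) (ξ : X → Fin k) (_ : Measurable ξ),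
    limsup (fun j => ((joinEntropy S (P j) ξ / ((P j).card : ℝ) : ℝ) : EReal)) atTop

/-- The progression `{j, 2j, …, L(j) j}`. -/
def progression (L : ℕ → ℕ) (j : ℕ) : Finset ℤ :=
  (Finset.Icc 1 (L j)).image fun n : ℕ => (n : ℤ) * (j : ℤ)

end PEntropy

end

/-!
By continuity of entropy in the weak topology, which the Halmos metric induces, the set of `S` whose
averaged entropies of a partition `ξ` exceed a number `M` for infinitely many `j` is a `Gδ`, and by
Baire category it suffices that it is dense when `M < H(ξ)`; as `μ` has no atoms, every `M` has such
a `ξ`. Given `T`, consider the tower of height `q` over the sequence space `X ^ ℤ`: its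
transformation applies `T` to every coordinate, and shifts the sequence once per round trip through
the levels. Read off at the coordinate `0`, it agrees with `T` outside one level, of measure
`1 / q`, while its powers with exponents at distance at least `q` read different, hence independent,
coordinates; along such exponents the averaged entropy of `ξ` is `H(ξ)`. An isomorphism modulo null
sets which respects finitely many labels carries the tower over to a transformation of `X` that is
close to `T`.
-/

namespace PEntropy

section Isomorphism

variable {X Y Z : Type*} [MeasurableSpace X] [MeasurableSpace Y] [MeasurableSpace Z]

/-- An isomorphism modulo null sets between two measure spaces. The two maps are defined everywhere
but are inverse to each other only almost everywhere. -/
structure AEIso (μ : Measure X) (ν : Measure Z) where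
  toFun : X → Z
  invFun : Z → X
  measurePreserving : MeasurePreserving toFun μ ν
  measurePreserving_invFun : MeasurePreserving invFun ν μ
  ae_left_inv : ∀ᵐ x ∂μ, invFun (toFun x) = x
  ae_right_inv : ∀ᵐ z ∂ν, toFun (invFun z) = z

namespace AEIso

variable {μ : Measure X} {ν : Measure Y} {κ : Measure Z}

instance : CoeFun (AEIso μ ν) fun _ => X → Y := ⟨toFun⟩

/-- The inverse of an isomorphism modulo null sets. -/
@[simps]
protected def symm (φ : AEIso μ ν) : AEIso ν μ :=
  ⟨φ.invFun, φ.toFun, φ.measurePreserving_invFun, φ.measurePreserving, φ.ae_right_inv,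
    φ.ae_left_inv⟩

/-- The composition `ψ ∘ φ` of isomorphisms modulo null sets. -/
@[simps]
protected def trans (φ : AEIso μ ν) (ψ : AEIso ν κ) : AEIso μ κ where
  toFun := ψ ∘ φ
  invFun := φ.invFun ∘ ψ.invFun
  measurePreserving := ψ.measurePreserving.comp φ.measurePreserving
  measurePreserving_invFun := φ.measurePreserving_invFun.comp ψ.measurePreserving_invFun
  ae_left_inv := by
    filter_upwards [φ.ae_left_inv, φ.measurePreserving.quasiMeasurePreserving.ae ψ.ae_left_inv]
      with x hφ hψ
    simp only [Function.comp_apply, hψ, hφ]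
  ae_right_inv := by
    filter_upwards [ψ.ae_right_inv,
      ψ.measurePreserving_invFun.quasiMeasurePreserving.ae φ.ae_right_inv] with z hψ hφ
    simp only [Function.comp_apply, hφ, hψ]

end AEIso

theorem exists_aeIso_map_of_injOn [Nonempty X] [StandardBorelSpace X] [StandardBorelSpace Z]
    (μ : Measure X) {g : X → Z} (hg : Measurable g) {s : Set X} (hs : MeasurableSet s)
    (hsμ : ∀ᵐ x ∂μ, x ∈ s) (hinj : s.InjOn g) : ∃ φ : AEIso μ (μ.map g), φ.toFun = g := by
  have := hs.standardBorel
  have hemb : MeasurableEmbedding fun x : s => g x :=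
    (hg.comp measurable_subtype_coe).measurableEmbedding fun x y hxy =>
      Subtype.ext (hinj x.2 y.2 hxy)
  obtain ⟨r, hr, hrg⟩ := hemb.exists_measurable_extend
    (g := fun x : s => (x : X)) measurable_subtype_coe fun _ => ‹Nonempty X›
  have hrg' : ∀ᵐ x ∂μ, r (g x) = x := hsμ.mono fun x hx => congrFun hrg ⟨x, hx⟩
  refine ⟨⟨g, r, ⟨hg, rfl⟩, ⟨hr, ?_⟩, hrg', ?_⟩, rfl⟩
  · rw [Measure.map_map hr hg]
    exact (Measure.map_congr hrg').trans Measure.map_id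
  · refine (ae_map_iff hg.aemeasurable (measurableSet_eq_fun (hg.comp hr) measurable_id)).2 ?_
    filter_upwards [hrg'] with x hx
    simp only [Function.comp_apply, id_eq, hx]

section Real

open ProbabilityTheory

variable (m m' : Measure ℝ) [IsProbabilityMeasure m] [NullSingletonClass m]
  [IsProbabilityMeasure m'] [NullSingletonClass m']

theorem continuous_cdf : Continuous (cdf m) := by
  refine continuous_iff_continuousAt.2 fun a => ?_
  have hmono : Monotone (cdf m) := monotone_cdf m
  rw [hmono.continuousAt_iff_leftLim_eq_rightLim, (cdf m).rightLim_eq]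
  have h : (cdf m).measure {a} = 0 := by rw [measure_cdf, measure_singleton]
  rw [StieltjesFunction.measure_singleton, ENNReal.ofReal_eq_zero, sub_nonpos] at h
  exact le_antisymm (hmono.leftLim_le le_rfl) h

theorem exists_cdf_eq {t : ℝ} (h0 : 0 < t) (h1 : t < 1) : ∃ s, cdf m s = t := by
  obtain ⟨a, ha⟩ := ((tendsto_cdf_atBot m).eventually (gt_mem_nhds h0)).exists
  obtain ⟨b, hb⟩ := ((tendsto_cdf_atTop m).eventually (lt_mem_nhds h1)).exists
  exact mem_range_of_exists_le_of_exists_ge (continuous_cdf m) ⟨a, ha.le⟩ ⟨b, hb.le⟩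

theorem measureReal_cdf_le {t : ℝ} (h0 : 0 ≤ t) (h1 : t < 1) : m.real {s | cdf m s ≤ t} = t := by
  refine le_antisymm (le_of_forall_gt_imp_ge_of_dense fun u hu => ?_) ?_
  · rcases le_or_gt 1 u with hu1 | hu1
    · exact measureReal_le_one.trans hu1
    obtain ⟨s, rfl⟩ := exists_cdf_eq m (h0.trans_lt hu) hu1
    rw [cdf_eq_real]
    exact measureReal_mono fun y hy => ((monotone_cdf m).reflect_lt (lt_of_le_of_lt hy hu)).le
  · rcases h0.eq_or_lt with rfl | h0
    · exact measureReal_nonneg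
    obtain ⟨s, rfl⟩ := exists_cdf_eq m h0 h1
    conv_lhs => rw [cdf_eq_real]
    exact measureReal_mono fun y hy => monotone_cdf m hy

theorem map_cdf : m.map (cdf m) = volume.restrict (Set.Icc 0 1) := by
  have hmeas : Measurable (cdf m) := (monotone_cdf m).measurable
  have := Measure.isProbabilityMeasure_map (μ := m) hmeas.aemeasurable
  refine Measure.ext_of_Iic _ _ fun t => ?_
  rw [Measure.map_apply hmeas measurableSet_Iic, Measure.restrict_apply measurableSet_Iic,
    Set.inter_comm, ← Set.Ici_inter_Iic, Set.inter_assoc, Set.Iic_inter_Iic, Set.Ici_inter_Iic,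
    Real.volume_Icc, sub_zero, ← ofReal_measureReal]
  change ENNReal.ofReal (m.real {s | cdf m s ≤ t}) = _
  rcases lt_or_ge t 0 with ht | ht
  · have h : {s | cdf m s ≤ t} = ∅ :=
      Set.eq_empty_of_forall_notMem fun s hs => (ht.trans_le (cdf_nonneg m s)).not_ge hs
    rw [h, measureReal_empty, ENNReal.ofReal_zero,
      ENNReal.ofReal_of_nonpos (min_le_of_right_le ht.le)]
  rcases lt_or_ge t 1 with ht1 | ht1
  · rw [measureReal_cdf_le m ht ht1, min_eq_right ht1.le]
  · have h : {s | cdf m s ≤ t} = Set.univ :=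
      Set.eq_univ_of_forall fun s => (cdf_le_one m s).trans ht1
    rw [h, probReal_univ, min_eq_left ht1]

theorem ae_cdf_ne (c : ℝ) : ∀ᵐ t ∂m, cdf m t ≠ c := by
  refine ae_of_ae_map (p := (· ≠ c)) (monotone_cdf m).measurable.aemeasurable ?_
  rw [map_cdf]
  exact Measure.ae_ne _ _

theorem ae_cdf_le_cdf_iff (s : ℝ) : ∀ᵐ t ∂m, cdf m t ≤ cdf m s ↔ t ≤ s := by
  filter_upwards [ae_cdf_ne m (cdf m s)] with t ht
  refine ⟨fun h => ?_, fun h => monotone_cdf m h⟩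
  exact ((monotone_cdf m).reflect_lt (lt_of_le_of_ne h ht)).le

theorem exists_aeIso_toFun_eq_cdf :
    ∃ φ : AEIso m (volume.restrict (Set.Icc (0 : ℝ) 1)), φ.toFun = cdf m := by
  have hmono := monotone_cdf m
  rw [← map_cdf m]
  refine exists_aeIso_map_of_injOn m hmono.measurable (s := {t | ∀ q : ℚ, cdf m t ≠ cdf m q}) ?_
    (ae_all_iff.2 fun q => ae_cdf_ne m _) fun x hx y hy hxy => ?_
  · rw [Set.ofPred_forall]
    exact MeasurableSet.iInter fun q => (hmono.measurable (measurableSet_singleton _)).compl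
  wlog h : x < y generalizing x y
  · by_contra hne
    exact hne (this y hy x hx hxy.symm ((Ne.symm hne).lt_of_le (not_lt.1 h))).symm
  obtain ⟨q, hxq, hqy⟩ := exists_rat_btwn h
  exact absurd (le_antisymm (hmono hxq.le) (hxy ▸ hmono hqy.le)) (hx q)

theorem exists_aeIso_forall_le_iff :
    ∃ φ : AEIso m m', ∀ s, cdf m s = cdf m' s → ∀ᵐ t ∂m, φ t ≤ s ↔ t ≤ s := by
  obtain ⟨α, hα⟩ := exists_aeIso_toFun_eq_cdf m
  obtain ⟨β, hβ⟩ := exists_aeIso_toFun_eq_cdf m'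
  refine ⟨α.trans β.symm, fun s hs => ?_⟩
  have hcdf : ∀ᵐ t ∂m, cdf m' (α.trans β.symm t) = cdf m t := by
    filter_upwards [α.measurePreserving.quasiMeasurePreserving.ae β.ae_right_inv] with t ht
    rw [hα, hβ] at ht
    simpa only [AEIso.trans_toFun, AEIso.symm_toFun, Function.comp_apply, hα] using ht
  filter_upwards [hcdf, ae_cdf_le_cdf_iff m s,
    (α.trans β.symm).measurePreserving.quasiMeasurePreserving.ae (ae_cdf_le_cdf_iff m' s)]
    with t h1 h2 h3
  rw [← h2, ← h3, h1, hs]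

end Real

section Labels

variable [StandardBorelSpace X] [StandardBorelSpace Z]
  (μ : Measure X) [IsProbabilityMeasure μ] [NullSingletonClass μ]
  (ν : Measure Z) [IsProbabilityMeasure ν] [NullSingletonClass ν]

theorem exists_measurable_injective_le_natCast_iff {f : X → ℕ} (hf : Measurable f) :
    ∃ h : X → ℝ, Measurable h ∧ Function.Injective h ∧ ∀ x (n : ℕ), h x ≤ n ↔ f x < n := by
  let h : X → ℝ := fun x => f x + Real.sigmoid (embeddingReal X x)
  have h_le_iff (x : X) (n : ℕ) : h x ≤ n ↔ f x < n := by
    have h0 := Real.sigmoid_pos (embeddingReal X x)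
    have h1 := Real.sigmoid_lt_one (embeddingReal X x)
    rw [← Nat.succ_le_iff, ← Nat.cast_le (α := ℝ), Nat.cast_succ]
    refine ⟨fun hn => ?_, fun hn => by simp only [h]; linarith⟩
    have : (f x : ℝ) < n := by simp only [h] at hn; linarith
    exact_mod_cast this
  refine ⟨h, (measurable_from_top.comp hf).add
    (continuous_sigmoid.measurable.comp (measurableEmbedding_embeddingReal X).measurable),
    fun x y hxy => ?_, h_le_iff⟩
  have hf_eq : f x = f y := eq_of_forall_gt_iff fun n => by rw [← h_le_iff, ← h_le_iff, hxy]
  have hsig : Real.sigmoid (embeddingReal X x) = Real.sigmoid (embeddingReal X y) := by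
    simpa only [h, hf_eq, add_right_inj] using hxy
  exact (measurableEmbedding_embeddingReal X).injective (Real.sigmoid_injective hsig)

theorem exists_aeIso_real {f : X → ℕ} (hf : Measurable f) :
    ∃ (m : Measure ℝ) (_ : IsProbabilityMeasure m) (_ : NullSingletonClass m) (φ : AEIso μ m),
      ∀ x (n : ℕ), φ x ≤ n ↔ f x < n := by
  have := μ.nonempty_of_neZero
  obtain ⟨h, hh, hinj, hle⟩ := exists_measurable_injective_le_natCast_iff hf
  obtain ⟨φ, hφ⟩ := exists_aeIso_map_of_injOn μ hh .univ (.of_forall Set.mem_univ) hinj.injOn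
  refine ⟨μ.map h, Measure.isProbabilityMeasure_map hh.aemeasurable, ⟨fun t => ?_⟩, φ,
    fun x n => by rw [hφ, hle]⟩
  rw [Measure.map_apply hh (measurableSet_singleton t)]
  exact (Set.subsingleton_singleton.preimage hinj).measure_zero _

theorem exists_aeIso_nat {f : X → ℕ} (hf : Measurable f) {g : Z → ℕ} (hg : Measurable g)
    (hfg : μ.map f = ν.map g) : ∃ φ : AEIso μ ν, ∀ᵐ x ∂μ, g (φ x) = f x := by
  obtain ⟨m, _, _, α, hα⟩ := exists_aeIso_real μ hf
  obtain ⟨m', _, _, β, hβ⟩ := exists_aeIso_real ν hg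
  obtain ⟨θ, hθ⟩ := exists_aeIso_forall_le_iff m m'
  have hcdf (n : ℕ) : ProbabilityTheory.cdf m n = ProbabilityTheory.cdf m' n := by
    have hα' : α ⁻¹' Set.Iic (n : ℝ) = f ⁻¹' Set.Iio n := Set.ext fun x => hα x n
    have hβ' : β ⁻¹' Set.Iic (n : ℝ) = g ⁻¹' Set.Iio n := Set.ext fun x => hβ x n
    rw [ProbabilityTheory.cdf_eq_real, ProbabilityTheory.cdf_eq_real,
      ← α.measurePreserving.measureReal_preimage measurableSet_Iic.nullMeasurableSet, hα',
      ← β.measurePreserving.measureReal_preimage measurableSet_Iic.nullMeasurableSet, hβ',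
      ← map_measureReal_apply hf measurableSet_Iio, hfg, map_measureReal_apply hg measurableSet_Iio]
  refine ⟨(α.trans θ).trans β.symm, ?_⟩
  filter_upwards [(α.trans θ).measurePreserving.quasiMeasurePreserving.ae β.ae_right_inv,
    α.measurePreserving.quasiMeasurePreserving.ae (ae_all_iff.2 fun n : ℕ => hθ n (hcdf n))]
    with x hβx hθx
  refine eq_of_forall_gt_iff fun n => ?_
  rw [← hα x n, ← hθx n, ← hβ, AEIso.trans_toFun, Function.comp_apply, AEIso.symm_toFun, hβx]
  rfl

theorem exists_aeIso_of_map_eq {ι : Type*} [Countable ι] [MeasurableSpace ι]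
    [MeasurableSingletonClass ι] {f : X → ι} (hf : Measurable f) {g : Z → ι} (hg : Measurable g)
    (hfg : μ.map f = ν.map g) : ∃ φ : AEIso μ ν, ∀ᵐ x ∂μ, g (φ x) = f x := by
  obtain ⟨e, he⟩ := Countable.exists_injective_nat ι
  have hem : Measurable e := measurable_of_countable e
  obtain ⟨φ, hφ⟩ := exists_aeIso_nat μ ν (hem.comp hf) (hem.comp hg)
    (by rw [← Measure.map_map hem hf, hfg, Measure.map_map hem hg])
  exact ⟨φ, hφ.mono fun x hx => he hx⟩

end Labels

end Isomorphism

section Realization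

variable {X Z : Type*} [MeasurableSpace X] [MeasurableSpace Z] {μ : Measure X} {ν : Measure Z}

theorem mem_MPPerm_of_measurePreserving [StandardBorelSpace X] {e : Equiv.Perm X}
    (he : MeasurePreserving e μ μ) : e ∈ MPPerm μ := by
  have hemb : MeasurableEmbedding e := he.measurable.measurableEmbedding e.injective
  have hinv : Measurable e.symm := fun s hs => by
    rw [← Equiv.image_eq_preimage_symm]
    exact hemb.measurableSet_image.2 hs
  exact ⟨he, MeasurePreserving.symm ⟨e, he.measurable, hinv⟩ he⟩

theorem exists_invariant_subset (σ : MPPerm ν) {B : Set Z} (hB : MeasurableSet B)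
    (hBν : ∀ᵐ z ∂ν, z ∈ B) :
    ∃ E ⊆ B, MeasurableSet E ∧ (∀ᵐ z ∂ν, z ∈ E) ∧ ∀ z, σ.1 z ∈ E ↔ z ∈ E := by
  refine ⟨⋂ n : ℤ, (σ ^ n).1 ⁻¹' B, Set.iInter_subset_of_subset 0 subset_rfl,
    .iInter fun n => (σ ^ n).2.1.measurable hB, ?_, fun z => ?_⟩
  · simpa only [Set.mem_iInter, Set.mem_preimage] using
      ae_all_iff.2 fun n : ℤ => (σ ^ n).2.1.quasiMeasurePreserving.ae hBν
  · simp only [Set.mem_iInter, Set.mem_preimage]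
    refine (Equiv.addRight (1 : ℤ)).forall_congr fun n => ?_
    rw [Equiv.coe_addRight, zpow_add_one]
    rfl

theorem AEIso.exists_semiconj [StandardBorelSpace X] [StandardBorelSpace Z] (φ : AEIso μ ν)
    (σ : MPPerm ν) : ∃ S : MPPerm μ, ∀ᵐ x ∂μ, φ (S.1 x) = σ.1 (φ x) := by
  classical
  have hφ := φ.measurePreserving
  have hψ := φ.measurePreserving_invFun
  obtain ⟨E, hE, hEm, hEν, hσE⟩ := exists_invariant_subset σ
    (measurableSet_eq_fun (hφ.measurable.comp hψ.measurable) measurable_id) φ.ae_right_inv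
  have hφψ : ∀ z ∈ E, φ (φ.invFun z) = z := fun z hz => hE hz
  let D : Set X := {x | φ.invFun (φ x) = x ∧ φ x ∈ E}
  have hDm : MeasurableSet D :=
    (measurableSet_eq_fun (hψ.measurable.comp hφ.measurable) measurable_id).inter
      (hφ.measurable hEm)
  have hDμ : ∀ᵐ x ∂μ, x ∈ D := φ.ae_left_inv.and (hφ.quasiMeasurePreserving.ae hEν)
  let e : E ≃ D :=
    { toFun z := ⟨φ.invFun z, by simp only [hφψ z z.2], by simp only [hφψ z z.2, z.2]⟩
      invFun x := ⟨φ x, x.2.2⟩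
      left_inv z := Subtype.ext (hφψ z z.2)
      right_inv x := Subtype.ext x.2.1 }
  let S : Equiv.Perm X := (σ.1.subtypePerm hσE).extendDomain e
  have hS : ∀ x ∈ D, S x = φ.invFun (σ.1 (φ x)) := fun x hx =>
    Equiv.Perm.extendDomain_apply_subtype _ e hx
  have hcomp : MeasurePreserving (fun x => φ.invFun (σ.1 (φ x))) μ μ := hψ.comp (σ.2.1.comp hφ)
  have hSm : Measurable S := by
    have hS_eq : ⇑S = D.piecewise (fun x => φ.invFun (σ.1 (φ x))) id := by
      funext x
      by_cases hx : x ∈ D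
      · rw [hS x hx, Set.piecewise_eq_of_mem _ _ _ hx]
      · rw [Set.piecewise_eq_of_notMem _ _ _ hx]
        exact Equiv.Perm.extendDomain_apply_not_subtype _ e hx
    exact hS_eq ▸ hcomp.measurable.piecewise hDm measurable_id
  have hSae : S =ᵐ[μ] fun x => φ.invFun (σ.1 (φ x)) := hDμ.mono hS
  refine ⟨⟨S, mem_MPPerm_of_measurePreserving ⟨hSm, ?_⟩⟩, hDμ.mono fun x hx => ?_⟩
  · rw [Measure.map_congr hSae, hcomp.map_eq]
  · exact (congrArg φ (hS x hx)).trans (hφψ _ ((hσE _).2 hx.2))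

theorem ae_comp_zpow {φ : X → Z} {S : MPPerm μ} {σ : MPPerm ν}
    (h : ∀ᵐ x ∂μ, φ (S.1 x) = σ.1 (φ x)) (n : ℤ) :
    ∀ᵐ x ∂μ, φ ((S ^ n).1 x) = (σ ^ n).1 (φ x) := by
  have hinv : ∀ᵐ x ∂μ, φ ((S⁻¹).1 x) = (σ⁻¹).1 (φ x) := by
    filter_upwards [S.2.2.quasiMeasurePreserving.ae h] with x hx
    exact (Equiv.eq_symm_apply σ.1).2 (hx.symm.trans (congrArg φ (S.1.apply_symm_apply x)))
  induction n using Int.induction_on with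
  | zero => exact .of_forall fun x => rfl
  | succ n ih =>
    filter_upwards [S.2.1.quasiMeasurePreserving.ae ih, h] with x h1 h2
    rw [zpow_add_one, zpow_add_one]
    exact h1.trans (congrArg _ h2)
  | pred n ih =>
    filter_upwards [S.2.2.quasiMeasurePreserving.ae ih, hinv] with x h1 h2
    rw [zpow_sub_one, zpow_sub_one]
    exact h1.trans (congrArg _ h2)

end Realization

section Tower

open ProbabilityTheory

variable {X Y ι κ : Type*} [MeasurableSpace X] [MeasurableSpace Y]

theorem measurePreserving_infinitePi_comp {μ : Measure X} {ν : Measure Y} [IsProbabilityMeasure μ]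
    [IsProbabilityMeasure ν] {f : κ → X → Y} (hf : ∀ k, MeasurePreserving (f k) μ ν) {e : κ → ι}
    (he : Function.Injective e) :
    MeasurePreserving (fun (x : ι → X) k => f k (x (e k)))
      (Measure.infinitePi fun _ => μ) (Measure.infinitePi fun _ => ν) := by
  have hfm := fun k => (hf k).measurable
  refine ⟨by fun_prop, ?_⟩
  calc (Measure.infinitePi fun _ : ι => μ).map (fun x k => f k (x (e k)))
      = ((Measure.infinitePi fun _ => μ).map (fun x k => x (e k))).map (fun y k => f k (y k)) := by
        rw [Measure.map_map (by fun_prop) (by fun_prop)]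
        rfl
    _ = Measure.infinitePi fun _ => ν := by
        rw [Measure.map_infinitePi_infinitePi_of_inj he, Measure.infinitePi_map_pi _ hfm]
        simp only [(hf _).map_eq]

theorem measurePreserving_uniformOn_univ [Finite ι] [MeasurableSpace ι]
    [MeasurableSingletonClass ι] (e : Equiv.Perm ι) :
    MeasurePreserving e (uniformOn Set.univ) (uniformOn Set.univ) := by
  have := Fintype.ofFinite ι
  refine ⟨measurable_of_countable _, Measure.ext fun s hs => ?_⟩
  rw [Measure.map_apply (measurable_of_countable _) hs, uniformOn_univ, uniformOn_univ,
    ← Measure.count_injective_image e.injective, Set.image_preimage_eq _ e.surjective]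

/-- The probability measure on the tower of height `q` over `ℤ → X`, whose points are pairs of a
level `t : ZMod q` and a sequence. -/
noncomputable def towerMeasure (μ : Measure X) (q : ℕ) [NeZero q] : Measure (ZMod q × (ℤ → X)) :=
  (uniformOn Set.univ).prod (Measure.infinitePi fun _ => μ)

variable {μ : Measure X} {q : ℕ} [NeZero q]

/-- The `n`-th power of the transformation of the tower that climbs one level, applies `T` to every
coordinate, and shifts the sequence by one place when it returns from the top to the bottom. After
`n` steps from level `t` it has returned `(t + n) / q` times. -/
def towerFlow (T : MPPerm μ) (q : ℕ) (n : ℤ) (z : ZMod q × (ℤ → X)) : ZMod q × (ℤ → X) :=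
  (z.1 + n, fun a => (T ^ n).1 (z.2 (a + (z.1.val + n) / q)))

theorem towerFlow_zero (T : MPPerm μ) (z : ZMod q × (ℤ → X)) : towerFlow T q 0 z = z := by
  have h : (z.1.val : ℤ) / q = 0 :=
    Int.ediv_eq_zero_of_lt (Int.natCast_nonneg _) (Int.ofNat_lt.2 z.1.val_lt)
  simp only [towerFlow, Int.cast_zero, add_zero, h, zpow_zero]
  rfl

theorem towerFlow_add (T : MPPerm μ) (m n : ℤ) (z : ZMod q × (ℤ → X)) :
    towerFlow T q (m + n) z = towerFlow T q m (towerFlow T q n z) := by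
  have hval : ((z.1 + n).val : ℤ) = (z.1.val + n) % q := by
    rw [← ZMod.val_intCast, Int.cast_add, Int.cast_natCast, ZMod.natCast_zmod_val]
  have hcarry : (z.1.val + (m + n)) / q =
      ((z.1.val + n) % q + m) / q + (z.1.val + n) / (q : ℤ) := by
    rw [← Int.add_mul_ediv_left _ _ (Int.natCast_ne_zero.2 (NeZero.ne q)), add_right_comm,
      Int.emod_add_mul_ediv]
    ring_nf
  refine Prod.ext ?_ (funext fun a => ?_)
  · simp only [towerFlow, Int.cast_add]
    ring
  · simp only [towerFlow, hval, hcarry, zpow_add, add_assoc]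
    rfl

variable [IsProbabilityMeasure μ]

instance : IsProbabilityMeasure (towerMeasure μ q) := by
  unfold towerMeasure
  infer_instance

theorem measurePreserving_tower_eval :
    MeasurePreserving (fun z : ZMod q × (ℤ → X) => z.2 0) (towerMeasure μ q) μ :=
  (measurePreserving_eval_infinitePi (fun _ => μ) 0).comp measurePreserving_snd

instance [NullSingletonClass μ] [MeasurableSingletonClass X] :
    NullSingletonClass (towerMeasure μ q) := ⟨fun z => by
  refine measure_mono_null (t := (fun z : ZMod q × (ℤ → X) => z.2 0) ⁻¹' {z.2 0}) (by simp) ?_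
  rw [measurePreserving_tower_eval.measure_preimage (measurableSet_singleton _).nullMeasurableSet,
    measure_singleton]⟩

theorem measurePreserving_towerFlow (T : MPPerm μ) (n : ℤ) :
    MeasurePreserving (towerFlow T q n) (towerMeasure μ q) (towerMeasure μ q) := by
  have hfib (t : ZMod q) := measurePreserving_infinitePi_comp (κ := ℤ) (fun _ => (T ^ n).2.1)
    (add_left_injective ((t.val + n) / (q : ℤ)))
  exact (measurePreserving_uniformOn_univ (Equiv.addRight (n : ZMod q))).skew_product
    (measurable_from_prod_countable_right fun t => (hfib t).measurable)
    (.of_forall fun t => (hfib t).map_eq)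

/-- The transformation of the tower with powers `towerFlow T q n`, as an automorphism. -/
def tower (T : MPPerm μ) (q : ℕ) [NeZero q] : MPPerm (towerMeasure μ q) where
  val :=
    { toFun := towerFlow T q 1
      invFun := towerFlow T q (-1)
      left_inv z := by rw [← towerFlow_add, neg_add_cancel, towerFlow_zero]
      right_inv z := by rw [← towerFlow_add, add_neg_cancel, towerFlow_zero] }
  property := ⟨measurePreserving_towerFlow T 1, measurePreserving_towerFlow T (-1)⟩

theorem tower_zpow (T : MPPerm μ) (n : ℤ) : ⇑(tower T q ^ n).1 = towerFlow T q n := by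
  induction n using Int.induction_on with
  | zero => exact funext fun z => (towerFlow_zero T z).symm
  | succ n ih =>
    funext z
    rw [towerFlow_add, ← ih, zpow_add_one]
    rfl
  | pred n ih =>
    funext z
    rw [sub_eq_add_neg, towerFlow_add, ← ih, ← sub_eq_add_neg, zpow_sub_one]
    rfl

theorem measureReal_tower_ne_le (T : MPPerm μ) (q : ℕ) [NeZero q] :
    (towerMeasure μ q).real {z | ((tower T q).1 z).2 0 ≠ T.1 (z.2 0)} ≤ 1 / q := by
  have hsub : {z : ZMod q × (ℤ → X) | ((tower T q).1 z).2 0 ≠ T.1 (z.2 0)} ⊆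
      {(-1 : ZMod q)} ×ˢ Set.univ := by
    rintro ⟨t, y⟩ hz
    refine ⟨?_, trivial⟩
    by_contra ht
    have hlt : t.val + 1 < q := by
      refine lt_of_le_of_ne (Nat.succ_le_of_lt t.val_lt) fun h => ht (eq_neg_of_add_eq_zero_left ?_)
      rw [← ZMod.natCast_zmod_val t, ← Nat.cast_succ, Nat.succ_eq_add_one, h, ZMod.natCast_self]
    have hdiv : ((t.val : ℤ) + 1) / q = 0 :=
      Int.ediv_eq_zero_of_lt (by positivity) (by exact_mod_cast hlt)
    refine hz ?_
    change (T ^ (1 : ℤ)).1 (y (0 + (t.val + 1) / q)) = T.1 (y 0)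
    rw [hdiv, zpow_one, add_zero]
  refine (measureReal_mono hsub).trans (le_of_eq ?_)
  rw [towerMeasure, measureReal_prod_prod, probReal_univ, mul_one, measureReal_def, uniformOn_univ,
    Measure.count_singleton, ZMod.card]
  simp

end Tower

section Entropy

open Real (negMulLog)

variable {X Z ι : Type*} [MeasurableSpace X] [MeasurableSpace Z] {μ : Measure X} {ν : Measure Z}

theorem partEntropy_congr [Fintype ι] {η η' : X → ι} (h : η =ᵐ[μ] η') :
    partEntropy μ η = partEntropy μ η' :=
  Finset.sum_congr rfl fun i _ => by rw [measureReal_congr (h.preimage {i})]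

theorem partEntropy_comp [Fintype ι] [MeasurableSpace ι] [MeasurableSingletonClass ι] {f : X → Z}
    (hf : MeasurePreserving f μ ν) {η : Z → ι} (hη : Measurable η) :
    partEntropy μ (η ∘ f) = partEntropy ν η :=
  Finset.sum_congr rfl fun i _ => by
    rw [Set.preimage_comp,
      hf.measureReal_preimage (hη (measurableSet_singleton i)).nullMeasurableSet]

theorem negMulLog_prod [Fintype ι] [DecidableEq ι] (b : ι → ℝ) :
    negMulLog (∏ i, b i) = ∑ j, ∏ i, if i = j then negMulLog (b i) else b i := by
  have h (j : ι) : (∏ i, if i = j then negMulLog (b i) else b i) =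
      (∏ i, b i) * -Real.log (b j) := by
    calc (∏ i, if i = j then negMulLog (b i) else b i)
        = ∏ i, b i * (if i = j then -Real.log (b i) else 1) :=
          Finset.prod_congr rfl fun i _ => by split_ifs <;> simp [negMulLog]
      _ = _ := by rw [Finset.prod_mul_distrib, Fintype.prod_ite_eq' j fun i => -Real.log (b i)]
  simp only [h, ← Finset.mul_sum, Finset.sum_neg_distrib]
  by_cases h0 : ∃ i, b i = 0
  · obtain ⟨i, hi⟩ := h0
    simp [Finset.prod_eq_zero (Finset.mem_univ i) hi]
  · push Not at h0
    rw [negMulLog, Real.log_prod fun i _ => h0 i, neg_mul_comm]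

theorem sum_negMulLog_prod [Fintype ι] [DecidableEq ι] {κ : ι → Type*} [∀ i, Fintype (κ i)]
    {a : ∀ i, κ i → ℝ} (ha : ∀ i, ∑ k, a i k = 1) :
    ∑ c : ∀ i, κ i, negMulLog (∏ i, a i (c i)) = ∑ i, ∑ k, negMulLog (a i k) := by
  simp only [negMulLog_prod]
  rw [Finset.sum_comm]
  refine Finset.sum_congr rfl fun j _ => ?_
  rw [← Fintype.prod_sum fun i k => if i = j then negMulLog (a i k) else a i k,
    Fintype.prod_eq_single j fun i hi => by simp only [hi, if_false, ha]]
  simp only [if_true]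

theorem partEntropy_pi_id [Fintype ι] [DecidableEq ι] {κ : ι → Type*} [∀ i, Fintype (κ i)]
    [∀ i, MeasurableSpace (κ i)] [∀ i, MeasurableSingletonClass (κ i)] (m : ∀ i, Measure (κ i))
    [∀ i, IsProbabilityMeasure (m i)] :
    partEntropy (Measure.pi m) id = ∑ i, partEntropy (m i) id := by
  simp only [partEntropy, Set.preimage_id]
  rw [← sum_negMulLog_prod fun i => by simp [sum_measureReal_singleton]]
  refine Finset.sum_congr rfl fun c _ => ?_
  rw [measureReal_def, Measure.pi_singleton, ENNReal.toReal_prod]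
  rfl

end Entropy

section Independence

/-- A finite set of integers has gaps of length at least `q`. -/
def IsSeparated (q : ℕ) (F : Finset ℤ) : Prop :=
  (F : Set ℤ).Pairwise fun a b => (q : ℤ) ≤ |a - b|

variable {X : Type*} [MeasurableSpace X] {μ : Measure X} [IsProbabilityMeasure μ] {q : ℕ} [NeZero q]
  {F : Finset ℤ} {k : ℕ} {ξ : X → Fin k}

theorem IsSeparated.injOn_add_neg_ediv (hF : IsSeparated q F) (t : ℤ) :
    (F : Set ℤ).InjOn fun p => (t + -p) / q := by
  intro a ha b hb hab
  by_contra hne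
  have hq : (0 : ℤ) < q := Int.natCast_pos.2 (NeZero.pos q)
  have ha' := Int.emod_add_mul_ediv (t + -a) q
  have hb' := Int.emod_add_mul_ediv (t + -b) q
  have ha₀ := Int.emod_nonneg (t + -a) hq.ne'
  have hb₀ := Int.emod_nonneg (t + -b) hq.ne'
  have ha₁ := Int.emod_lt_of_pos (t + -a) hq
  have hb₁ := Int.emod_lt_of_pos (t + -b) hq
  have hlt : |a - b| < q := by
    simp only at hab
    rw [hab] at ha'
    exact abs_sub_lt_iff.2 ⟨by linarith, by linarith⟩
  exact hlt.not_ge (hF ha hb hne)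

theorem measurePreserving_joinPartition_tower (T : MPPerm μ)
    (hF : IsSeparated q F) (hξ : Measurable ξ) :
    MeasurePreserving (joinPartition (tower T q) F fun z => ξ (z.2 0)) (towerMeasure μ q)
      (Measure.pi fun _ : F => μ.map ξ) := by
  have := Measure.isProbabilityMeasure_map (μ := μ) hξ.aemeasurable
  have hfib (t : ZMod q) := measurePreserving_infinitePi_comp
    (f := fun (p : F) x => ξ ((T ^ (-p : ℤ)).1 x))
    (fun p => (hξ.measurePreserving μ).comp (T ^ (-p : ℤ)).2.1)
    (e := fun p : F => (t.val + -(p : ℤ)) / (q : ℤ)) (hF.injOn_add_neg_ediv t.val).injective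
  simp only [Measure.infinitePi_eq_pi] at hfib
  have heq : (joinPartition (tower T q) F fun z => ξ (z.2 0)) = fun z (p : F) =>
      ξ ((T ^ (-p : ℤ)).1 (z.2 ((z.1.val + -(p : ℤ)) / (q : ℤ)))) := by
    funext z p
    rw [joinPartition, ← zpow_neg, tower_zpow]
    simp only [towerFlow, zero_add]
  rw [heq]
  exact measurePreserving_snd.comp
    ((MeasurePreserving.id (ProbabilityTheory.uniformOn Set.univ)).skew_product
      (measurable_from_prod_countable_right fun t => (hfib t).measurable)
      (.of_forall fun t => (hfib t).map_eq))

theorem partEntropy_joinPartition_tower (T : MPPerm μ)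
    (hF : IsSeparated q F) (hξ : Measurable ξ) :
    partEntropy (towerMeasure μ q) (joinPartition (tower T q) F fun z => ξ (z.2 0)) =
      F.card * partEntropy μ ξ := by
  have := Measure.isProbabilityMeasure_map (μ := μ) hξ.aemeasurable
  calc partEntropy (towerMeasure μ q) (joinPartition (tower T q) F fun z => ξ (z.2 0))
      = partEntropy (Measure.pi fun _ : F => μ.map ξ) id :=
        partEntropy_comp (measurePreserving_joinPartition_tower T hF hξ) measurable_id
    _ = F.card * partEntropy (μ.map ξ) id := by
        rw [partEntropy_pi_id, Finset.sum_const, Finset.card_univ, Fintype.card_coe, nsmul_eq_mul]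
    _ = F.card * partEntropy μ ξ := by
        rw [← partEntropy_comp (hξ.measurePreserving μ) measurable_id, Function.id_comp]

end Independence

section Approximation

variable {X Z : Type*} [MeasurableSpace X] [MeasurableSpace Z] {μ : Measure X} {ν : Measure Z}

theorem measurable_joinPartition (S : MPPerm μ) (F : Finset ℤ) {k : ℕ} {ξ : X → Fin k}
    (hξ : Measurable ξ) : Measurable (joinPartition S F ξ) :=
  measurable_pi_lambda _ fun p => hξ.comp (S ^ (p : ℤ))⁻¹.2.1.measurable

theorem joinPartition_ae_eq_comp {S : MPPerm μ} {σ : MPPerm ν} {φ : X → Z}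
    (hφ : ∀ᵐ x ∂μ, φ (S.1 x) = σ.1 (φ x)) {k : ℕ} {ξ : X → Fin k} {ζ : Z → Fin k}
    (hξ : ∀ᵐ x ∂μ, ζ (φ x) = ξ x) (F : Finset ℤ) :
    joinPartition S F ξ =ᵐ[μ] joinPartition σ F ζ ∘ φ := by
  have h : ∀ p : F, ∀ᵐ x ∂μ, ξ ((S ^ (-p : ℤ)).1 x) = ζ ((σ ^ (-p : ℤ)).1 (φ x)) := fun p => by
    filter_upwards [ae_comp_zpow hφ (-p), (S ^ (-p : ℤ)).2.1.quasiMeasurePreserving.ae hξ]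
      with x hx hξx
    rw [← hξx, hx]
  filter_upwards [ae_all_iff.2 h] with x hx
  funext p
  simpa only [joinPartition, Function.comp_apply, ← zpow_neg] using hx p

variable [StandardBorelSpace X] [IsProbabilityMeasure μ] [NullSingletonClass μ]

theorem exists_partEntropy_joinPartition_eq {ι : Type*} [Countable ι] [MeasurableSpace ι]
    [MeasurableSingletonClass ι] (T : MPPerm μ) {q : ℕ} [NeZero q] {F : Finset ℤ}
    (hF : IsSeparated q F) {k : ℕ} {ξ : X → Fin k} (hξ : Measurable ξ) {g : X → ι}
    (hg : Measurable g) :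
    ∃ S : MPPerm μ, μ.real {x | g (S.1 x) ≠ g (T.1 x)} ≤ 1 / q ∧
      partEntropy μ (joinPartition S F ξ) = F.card * partEntropy μ ξ := by
  have hT := T.2.1.measurable
  let label : X → Fin k × ι × ι := fun x => (ξ x, g x, g (T.1 x))
  have hlabel : Measurable label := hξ.prodMk (hg.prodMk (hg.comp hT))
  have heval : MeasurePreserving (fun z : ZMod q × (ℤ → X) => z.2 0) (towerMeasure μ q) μ :=
    measurePreserving_tower_eval
  obtain ⟨φ, hφ⟩ := exists_aeIso_of_map_eq μ (towerMeasure μ q) hlabel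
    (hlabel.comp heval.measurable) (by rw [← Measure.map_map hlabel heval.measurable, heval.map_eq])
  obtain ⟨S, hS⟩ := φ.exists_semiconj (tower T q)
  refine ⟨S, ?_, ?_⟩
  · have hmeas : MeasurableSet {z | ((tower T q).1 z).2 0 ≠ T.1 (z.2 0)} :=
      (measurableSet_eq_fun (heval.measurable.comp (tower T q).2.1.measurable)
        (hT.comp heval.measurable)).compl
    refine le_trans ?_ (measureReal_tower_ne_le T q)
    rw [← φ.measurePreserving.measureReal_preimage hmeas.nullMeasurableSet]
    refine ENNReal.toReal_mono (measure_ne_top _ _) (measure_mono_ae ?_)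
    filter_upwards [hS, hφ, S.2.1.quasiMeasurePreserving.ae hφ] with x hSx hφx hφSx hne heq
    have h₁ : g ((φ (S.1 x)).2 0) = g (S.1 x) := congrArg (·.2.1) hφSx
    have h₂ : g (T.1 ((φ x).2 0)) = g (T.1 x) := congrArg (·.2.2) hφx
    exact hne (by rw [← h₁, hSx, heq, h₂])
  · have hξφ : ∀ᵐ x ∂μ, ξ ((φ x).2 0) = ξ x := hφ.mono fun x hx => congrArg Prod.fst hx
    have hζ : Measurable fun z : ZMod q × (ℤ → X) => ξ (z.2 0) := hξ.comp heval.measurable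
    rw [partEntropy_congr (joinPartition_ae_eq_comp (ζ := fun z => ξ (z.2 0)) hS hξφ F),
      partEntropy_comp φ.measurePreserving (measurable_joinPartition _ F hζ),
      partEntropy_joinPartition_tower T hF hξ]

theorem exists_partEntropy_eq_log (μ : Measure X) [IsProbabilityMeasure μ] [NullSingletonClass μ]
    (k : ℕ) [NeZero k] : ∃ ξ : X → Fin k, Measurable ξ ∧ partEntropy μ ξ = Real.log k := by
  let ν : Measure (Fin k × X) := (ProbabilityTheory.uniformOn Set.univ).prod μ
  have : NullSingletonClass ν := ⟨fun z => by
    rw [← Set.singleton_prod_singleton, Measure.prod_prod, measure_singleton (μ := μ), mul_zero]⟩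
  obtain ⟨φ, -⟩ := exists_aeIso_of_map_eq μ ν (measurable_const (a := ()))
    (measurable_const (a := ())) (by simp)
  have hξ : MeasurePreserving (fun x => (φ x).1) μ (ProbabilityTheory.uniformOn Set.univ) :=
    measurePreserving_fst.comp φ.measurePreserving
  refine ⟨fun x => (φ x).1, hξ.measurable, ?_⟩
  have hcell (i : Fin k) : μ.real ((fun x => (φ x).1) ⁻¹' {i}) = (k : ℝ)⁻¹ := by
    rw [hξ.measureReal_preimage (measurableSet_singleton i).nullMeasurableSet, measureReal_def,
      ProbabilityTheory.uniformOn_univ, Measure.count_singleton]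
    simp
  simp only [partEntropy, hcell, Finset.sum_const, Finset.card_univ, Fintype.card_fin,
    nsmul_eq_mul, Real.negMulLog, Real.log_inv]
  field [NeZero.ne k]

theorem exists_lt_partEntropy (μ : Measure X) [IsProbabilityMeasure μ] [NullSingletonClass μ]
    (M : ℝ) : ∃ (k : ℕ) (ξ : X → Fin k), Measurable ξ ∧ M < partEntropy μ ξ := by
  obtain ⟨k, hk⟩ := exists_nat_gt (Real.exp M)
  have hk₀ : (0 : ℝ) < k := (Real.exp_pos M).trans hk
  have : NeZero k := ⟨(Nat.cast_pos.1 hk₀).ne'⟩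
  obtain ⟨ξ, hξ, hent⟩ := exists_partEntropy_eq_log μ k
  exact ⟨k, ξ, hξ, hent ▸ (Real.lt_log_iff_exp_lt hk₀).2 hk⟩

end Approximation

section WeakTopology

variable {X : Type*} [MeasurableSpace X] {μ : Measure X}

theorem measureReal_preimage_symmDiff (S : MPPerm μ) {B C : Set X} (hB : MeasurableSet B)
    (hC : MeasurableSet C) : μ.real ((S.1 ⁻¹' B) ∆ (S.1 ⁻¹' C)) = μ.real (B ∆ C) := by
  rw [← Set.preimage_symmDiff]
  exact S.2.1.measureReal_preimage (hB.symmDiff hC).nullMeasurableSet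

variable {β : Type*} {l : Filter β} {T T' : β → MPPerm μ} {S S' : MPPerm μ}

/-- Convergence in the weak topology on `Aut μ`, for representatives. Convergence of the inverses,
which the Halmos metric asks for explicitly, follows because `μ` is preserved. -/
def TendstoWeak (l : Filter β) (T : β → MPPerm μ) (S : MPPerm μ) : Prop :=
  ∀ B, MeasurableSet B → Tendsto (fun b => μ.real ((S.1 ⁻¹' B) ∆ ((T b).1 ⁻¹' B))) l (𝓝 0)

theorem TendstoWeak.inv (h : TendstoWeak l T S) : TendstoWeak l (fun b => (T b)⁻¹) S⁻¹ := by
  intro B hB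
  have hSB : MeasurableSet ((S⁻¹).1 ⁻¹' B) := (S⁻¹).2.1.measurable hB
  refine (h _ hSB).congr fun b => ?_
  have hcancel (R : MPPerm μ) (C : Set X) : R.1 ⁻¹' ((R⁻¹).1 ⁻¹' C) = C :=
    R.1.preimage_symm_preimage C
  calc μ.real ((S.1 ⁻¹' ((S⁻¹).1 ⁻¹' B)) ∆ ((T b).1 ⁻¹' ((S⁻¹).1 ⁻¹' B)))
      = μ.real (((T b).1 ⁻¹' ((S⁻¹).1 ⁻¹' B)) ∆ ((T b).1 ⁻¹' (((T b)⁻¹).1 ⁻¹' B))) := by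
        rw [hcancel, hcancel, symmDiff_comm]
    _ = μ.real (((S⁻¹).1 ⁻¹' B) ∆ (((T b)⁻¹).1 ⁻¹' B)) :=
        measureReal_preimage_symmDiff (T b) hSB ((T b)⁻¹.2.1.measurable hB)

variable [IsProbabilityMeasure μ]

theorem TendstoWeak.of_isDenseFamily {A : ℕ → Set X} (hA : IsDenseFamily μ A)
    (h : ∀ i, Tendsto (fun b => μ.real ((S.1 ⁻¹' A i) ∆ ((T b).1 ⁻¹' A i))) l (𝓝 0)) :
    TendstoWeak l T S := by
  intro B hB
  refine tendsto_order.2 ⟨fun a ha => .of_forall fun b => ha.trans_le measureReal_nonneg,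
    fun ε hε => ?_⟩
  obtain ⟨i, hi⟩ := hA.2 B hB (ε / 4) (by positivity)
  filter_upwards [(h i).eventually (gt_mem_nhds (show (0 : ℝ) < ε / 4 by positivity))] with b hb
  have h₁ := measureReal_symmDiff_le (μ := μ) (s := S.1 ⁻¹' B) (t := S.1 ⁻¹' A i) ((T b).1 ⁻¹' B)
  have h₂ := measureReal_symmDiff_le (μ := μ) (s := S.1 ⁻¹' A i) (t := (T b).1 ⁻¹' A i)
    ((T b).1 ⁻¹' B)
  rw [measureReal_preimage_symmDiff S hB (hA.1 i), symmDiff_comm B] at h₁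
  rw [measureReal_preimage_symmDiff (T b) (hA.1 i) hB] at h₂
  linarith

theorem TendstoWeak.mul (h : TendstoWeak l T S) (h' : TendstoWeak l T' S') :
    TendstoWeak l (fun b => T b * T' b) (S * S') := by
  intro B hB
  refine squeeze_zero (fun _ => measureReal_nonneg) (fun b => ?_)
    (by simpa only [add_zero] using (h' _ (S.2.1.measurable hB)).add (h B hB))
  rw [← measureReal_preimage_symmDiff (T' b) (S.2.1.measurable hB) ((T b).2.1.measurable hB)]
  exact measureReal_symmDiff_le (μ := μ) (s := S'.1 ⁻¹' (S.1 ⁻¹' B)) (t := (T' b).1 ⁻¹' (S.1 ⁻¹' B))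
    ((T' b).1 ⁻¹' ((T b).1 ⁻¹' B))

theorem TendstoWeak.zpow (h : TendstoWeak l T S) (n : ℤ) :
    TendstoWeak l (fun b => T b ^ n) (S ^ n) := by
  induction n using Int.induction_on with
  | zero =>
    intro B _
    simpa only [zpow_zero, symmDiff_self, Set.bot_eq_empty, measureReal_empty] using
      tendsto_const_nhds
  | succ n ih => simpa only [zpow_add_one] using ih.mul h
  | pred n ih => simpa only [zpow_sub_one] using ih.mul h.inv

theorem TendstoWeak.measureReal_ne {ι : Type*} [Finite ι] [MeasurableSpace ι]
    [MeasurableSingletonClass ι] (h : TendstoWeak l T S) {ξ : X → ι} (hξ : Measurable ξ) :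
    Tendsto (fun b => μ.real {x | ξ ((T b).1 x) ≠ ξ (S.1 x)}) l (𝓝 0) := by
  have := Fintype.ofFinite ι
  have hsum := tendsto_finsetSum Finset.univ fun i (_ : i ∈ Finset.univ) =>
    h (ξ ⁻¹' {i}) (hξ (measurableSet_singleton i))
  rw [Finset.sum_const_zero] at hsum
  refine squeeze_zero (fun _ => measureReal_nonneg) (fun b => ?_) hsum
  refine (measureReal_mono fun x hx => ?_).trans (measureReal_iUnion_fintype_le _)
  exact Set.mem_iUnion.2 ⟨ξ (S.1 x), Or.inl ⟨rfl, hx⟩⟩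

theorem tendsto_partEntropy {ι : Type*} [Fintype ι] [MeasurableSpace ι]
    [MeasurableSingletonClass ι] {η : β → X → ι} {η₀ : X → ι} (hη : ∀ b, Measurable (η b))
    (hη₀ : Measurable η₀) (h : Tendsto (fun b => μ.real {x | η b x ≠ η₀ x}) l (𝓝 0)) :
    Tendsto (fun b => partEntropy μ (η b)) l (𝓝 (partEntropy μ η₀)) := by
  refine tendsto_finsetSum _ fun i _ => (Real.continuous_negMulLog.tendsto _).comp ?_
  rw [tendsto_iff_dist_tendsto_zero]
  refine squeeze_zero (fun _ => dist_nonneg) (fun b => ?_) h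
  have hi := measurableSet_singleton i
  refine (abs_measureReal_sub_le_measureReal_symmDiff (hη b hi).nullMeasurableSet
    (hη₀ hi).nullMeasurableSet).trans (measureReal_mono ?_)
  rintro x (⟨hx, hx₀⟩ | ⟨hx₀, hx⟩) heq
  · exact hx₀ (heq.symm.trans hx)
  · exact hx (heq.trans hx₀)

theorem TendstoWeak.partEntropy_joinPartition (h : TendstoWeak l T S) (F : Finset ℤ) {k : ℕ}
    {ξ : X → Fin k} (hξ : Measurable ξ) :
    Tendsto (fun b => partEntropy μ (joinPartition (T b) F ξ)) l
      (𝓝 (partEntropy μ (joinPartition S F ξ))) := by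
  refine tendsto_partEntropy (fun b => measurable_joinPartition _ F hξ)
    (measurable_joinPartition S F hξ) ?_
  have hsum := tendsto_finsetSum Finset.univ fun (p : F) _ => (h.zpow p).inv.measureReal_ne hξ
  rw [Finset.sum_const_zero] at hsum
  refine squeeze_zero (fun _ => measureReal_nonneg) (fun b => ?_) hsum
  refine (measureReal_mono fun x hx => ?_).trans (measureReal_iUnion_fintype_le _)
  exact Set.mem_iUnion.2 (Function.ne_iff.1 hx)

theorem halmosTerm_le_halmosDist (A : ℕ → Set X) (S T : MPPerm μ) (i : ℕ) :
    halmosTerm μ (A i) S T ≤ 2 ^ (i + 1) * halmosDist μ A S T := by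
  have h : (1 / 2 : ℝ) ^ (i + 1) * halmosTerm μ (A i) S T ≤ halmosDist μ A S T :=
    (halmos_summable A S T).le_tsum i fun k _ =>
      mul_nonneg (by positivity) (halmosTerm_nonneg _ _ _)
  rwa [one_div, inv_pow, inv_mul_le_iff₀ (by positivity)] at h

theorem tendsto_halmosDist {A : ℕ → Set X}
    (h : ∀ i, Tendsto (fun b => halmosTerm μ (A i) S (T b)) l (𝓝 0)) :
    Tendsto (fun b => halmosDist μ A S (T b)) l (𝓝 0) := by
  rw [← tsum_zero (β := ℕ)]
  refine tendsto_tsum_of_dominated_convergence summable_geometric_two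
    (fun i => by simpa only [mul_zero] using (h i).const_mul ((1 / 2 : ℝ) ^ (i + 1)))
    (.of_forall fun b i => ?_)
  rw [Real.norm_of_nonneg (mul_nonneg (by positivity) (halmosTerm_nonneg _ _ _))]
  calc (1 / 2 : ℝ) ^ (i + 1) * halmosTerm μ (A i) S (T b)
      ≤ (1 / 2 : ℝ) ^ (i + 1) * 2 :=
        mul_le_mul_of_nonneg_left (halmosTerm_le _ _ _) (by positivity)
    _ = (1 / 2 : ℝ) ^ i := by ring

variable [StandardBorelSpace X] {A : ℕ → Set X}

theorem tendsto_coe_iff_tendstoWeak (hA : IsDenseFamily μ A) :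
    letI := halmosMetric μ hA
    Tendsto (fun b => (T b : Aut μ)) l (𝓝 (S : Aut μ)) ↔ TendstoWeak l T S := by
  let := halmosMetric μ hA
  have hdist : Tendsto (fun b => (T b : Aut μ)) l (𝓝 (S : Aut μ)) ↔
      Tendsto (fun b => halmosDist μ A S (T b)) l (𝓝 0) := by
    rw [tendsto_iff_dist_tendsto_zero]
    simp only [dist_comm _ (S : Aut μ)]
    rfl
  rw [hdist]
  refine ⟨fun h => .of_isDenseFamily hA fun i => ?_, fun h => tendsto_halmosDist fun i => ?_⟩
  · refine squeeze_zero (fun _ => measureReal_nonneg) (fun b => ?_)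
      (by simpa only [mul_zero] using h.const_mul ((2 : ℝ) ^ (i + 1)))
    refine le_trans ?_ (halmosTerm_le_halmosDist A S (T b) i)
    rw [halmosTerm, image_inv_eq_preimage, image_inv_eq_preimage]
    exact le_add_of_nonneg_left measureReal_nonneg
  · simpa only [halmosTerm, image_eq_preimage_inv, inv_inv, add_zero] using
      (h.inv (A i) (hA.1 i)).add (h (A i) (hA.1 i))

theorem continuous_joinEntropy (hA : IsDenseFamily μ A) (F : Finset ℤ) {k : ℕ} {ξ : X → Fin k}
    (hξ : Measurable ξ) :
    letI := halmosMetric μ hA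
    Continuous fun S : Aut μ => joinEntropy S F ξ := by
  let := halmosMetric μ hA
  refine continuous_iff_continuousAt.2 fun S => ?_
  induction S using Con.induction_on with | _ S
  have hsurj : Function.Surjective fun T : MPPerm μ => (T : Aut μ) := Quotient.mk_surjective
  rw [ContinuousAt, ← map_comap_of_surjective hsurj (𝓝 (S : Aut μ)), tendsto_map'_iff]
  exact ((tendsto_coe_iff_tendstoWeak hA).1 tendsto_comap).partEntropy_joinPartition F hξ

end WeakTopology

section Typical

theorem setOf_frequently_mem_mem_residual {Y : Type*} [TopologicalSpace Y] {U : ℕ → Set Y}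
    (hU : ∀ j, IsOpen (U j)) (hdense : ∀ n, Dense (⋃ j ≥ n, U j)) :
    {y | ∃ᶠ j in atTop, y ∈ U j} ∈ residual Y := by
  have hfreq : {y | ∃ᶠ j in atTop, y ∈ U j} = ⋂ n, ⋃ j ≥ n, U j := by
    ext y
    simp only [frequently_atTop, Set.mem_ofPred_eq, Set.mem_iInter, Set.mem_iUnion, exists_prop]
  rw [hfreq]
  exact countable_iInter_mem.2 fun n =>
    residual_of_dense_open (isOpen_biUnion fun j _ => hU j) (hdense n)

variable {X : Type*} [MeasurableSpace X] {μ : Measure X} {P : ℕ → Finset ℤ}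

theorem pEntropy_eq_top {S : Aut μ}
    (h : ∀ M : ℕ, ∃ (k : ℕ) (ξ : X → Fin k), Measurable ξ ∧
      ∃ᶠ j in atTop, (M : ℝ) < joinEntropy S (P j) ξ / (P j).card) :
    pEntropy P S = ⊤ := by
  refine (EReal.eq_top_iff_forall_lt _).2 fun y => ?_
  obtain ⟨M, hM⟩ := exists_nat_gt y
  obtain ⟨k, ξ, hξ, hfreq⟩ := h M
  calc (y : EReal) < (M : ℝ) := EReal.coe_lt_coe_iff.2 hM
    _ ≤ limsup (fun j => ((joinEntropy S (P j) ξ / ((P j).card : ℝ) : ℝ) : EReal)) atTop :=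
        le_limsup_of_frequently_le' (hfreq.mono fun j hj => EReal.coe_le_coe_iff.2 hj.le)
    _ ≤ pEntropy P S := le_iSup_of_le k (le_iSup_of_le ξ (le_iSup_of_le hξ le_rfl))

variable [StandardBorelSpace X] [IsProbabilityMeasure μ] [NullSingletonClass μ] {A : ℕ → Set X}
  {k : ℕ} {ξ : X → Fin k}

theorem exists_tendstoWeak_joinEntropy_eq (hA : IsDenseFamily μ A)
    (hP : ∀ q : ℕ, ∃ᶠ j in atTop, (P j).Nonempty ∧ IsSeparated q (P j)) (hξ : Measurable ξ)
    (T : MPPerm μ) (n : ℕ) :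
    ∃ S : ℕ → MPPerm μ, TendstoWeak atTop S T ∧
      ∀ q, ∃ j ≥ n, joinEntropy (S q : Aut μ) (P j) ξ / (P j).card = partEntropy μ ξ := by
  have hstep (q : ℕ) : ∃ S : MPPerm μ,
      (∀ i < q, μ.real ((T.1 ⁻¹' A i) ∆ (S.1 ⁻¹' A i)) ≤ 1 / ((q : ℝ) + 1)) ∧
        ∃ j ≥ n, joinEntropy (S : Aut μ) (P j) ξ / (P j).card = partEntropy μ ξ := by
    obtain ⟨j, hj, hne, hsep⟩ := (frequently_atTop.1 (hP (q + 1))) n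
    have hmem : Measurable fun x (i : Fin q) => x ∈ A i :=
      measurable_pi_lambda _ fun i => measurableSet_setOfPred.1 (hA.1 i)
    obtain ⟨S, hST, hent⟩ := exists_partEntropy_joinPartition_eq T hsep hξ hmem
    refine ⟨S, fun i hi => ?_, j, hj, ?_⟩
    · rw [← Nat.cast_succ]
      refine (measureReal_mono fun x hx heq => ?_).trans hST
      have hiff : S.1 x ∈ A i ↔ T.1 x ∈ A i := iff_of_eq (congrFun heq ⟨i, hi⟩)
      exact hx.elim (fun h => h.2 (hiff.2 h.1)) (fun h => h.2 (hiff.1 h.1))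
    · exact (div_eq_iff (Nat.cast_ne_zero.2 hne.card_ne_zero)).2 (hent.trans (mul_comm _ _))
  choose S hS hent using hstep
  refine ⟨S, .of_isDenseFamily hA fun i => ?_, hent⟩
  refine squeeze_zero' (.of_forall fun _ => measureReal_nonneg) ?_
    (tendsto_one_div_add_atTop_nhds_zero_nat (𝕜 := ℝ))
  exact (eventually_gt_atTop i).mono fun q hq => hS q i hq

theorem frequently_lt_joinEntropy_mem_residual (hA : IsDenseFamily μ A)
    (hP : ∀ q : ℕ, ∃ᶠ j in atTop, (P j).Nonempty ∧ IsSeparated q (P j)) (hξ : Measurable ξ)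
    {M : ℝ} (hM : M < partEntropy μ ξ) :
    letI := halmosMetric μ hA
    {S : Aut μ | ∃ᶠ j in atTop, M < joinEntropy S (P j) ξ / (P j).card} ∈ residual (Aut μ) := by
  let := halmosMetric μ hA
  refine setOf_frequently_mem_mem_residual
    (U := fun j => {S : Aut μ | M < joinEntropy S (P j) ξ / (P j).card})
    (fun j => isOpen_lt continuous_const ((continuous_joinEntropy hA _ hξ).div_const _))
    fun n T => ?_
  induction T using Con.induction_on with | _ T
  obtain ⟨S, hS, hent⟩ := exists_tendstoWeak_joinEntropy_eq hA hP hξ T n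
  refine mem_closure_of_tendsto ((tendsto_coe_iff_tendstoWeak hA).2 hS) (.of_forall fun q => ?_)
  obtain ⟨j, hj, hq⟩ := hent q
  exact Set.mem_biUnion hj (hM.trans_eq hq.symm)

theorem isSeparated_progression (L : ℕ → ℕ) {q j : ℕ} (hqj : q ≤ j) :
    IsSeparated q (progression L j) := by
  intro a ha b hb hab
  obtain ⟨m, -, rfl⟩ := Finset.mem_image.1 (Finset.mem_coe.1 ha)
  obtain ⟨n, -, rfl⟩ := Finset.mem_image.1 (Finset.mem_coe.1 hb)
  have hmn : (1 : ℤ) ≤ |(m : ℤ) - n| :=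
    Int.one_le_abs (sub_ne_zero.2 fun h => hab (congrArg (· * (j : ℤ)) h))
  calc (q : ℤ) ≤ 1 * j := by rw [one_mul]; exact_mod_cast hqj
    _ ≤ |(m : ℤ) - n| * j := by gcongr
    _ = |(m : ℤ) * j - n * j| := by rw [← sub_mul, abs_mul, Nat.abs_cast]

theorem progression_nonempty {L : ℕ → ℕ} {j : ℕ} (hj : 1 ≤ L j) : (progression L j).Nonempty :=
  (Finset.nonempty_Icc.2 hj).image _

theorem frequently_isSeparated_progression {L : ℕ → ℕ} (hL : Tendsto L atTop atTop) (q : ℕ) :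
    ∃ᶠ j in atTop, (progression L j).Nonempty ∧ IsSeparated q (progression L j) := by
  refine Eventually.frequently ?_
  filter_upwards [eventually_ge_atTop q, hL.eventually_ge_atTop 1] with j hqj hLj
  exact ⟨progression_nonempty hLj, isSeparated_progression L hqj⟩

end Typical

end PEntropy

theorem theorem7p1_general {X : Type*} [MeasurableSpace X] [StandardBorelSpace X]
    (μ : Measure X) [IsProbabilityMeasure μ] [NullSingletonClass μ]
    (A : ℕ → Set X) (hA : PEntropy.IsDenseFamily μ A) (P : ℕ → Finset ℤ)
    (hP : ∀ q : ℕ, ∃ᶠ j in atTop, (P j).Nonempty ∧ PEntropy.IsSeparated q (P j)) :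
    letI := PEntropy.halmosMetric μ hA
    PEntropy.IsTypical {S : PEntropy.Aut μ | PEntropy.pEntropy P S = ⊤} := by
  let := PEntropy.halmosMetric μ hA
  choose k ξ hξ hM using fun M : ℕ => PEntropy.exists_lt_partEntropy μ M
  rw [PEntropy.IsTypical, IsMeagre, compl_compl]
  have hres := countable_iInter_mem.2 fun M =>
    PEntropy.frequently_lt_joinEntropy_mem_residual hA hP (hξ M) (hM M)
  exact mem_of_superset hres fun S hS =>
    PEntropy.pEntropy_eq_top fun M => ⟨k M, ξ M, hξ M, Set.mem_iInter.1 hS M⟩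

theorem theorem7p1 {X : Type*} [MeasurableSpace X] [StandardBorelSpace X]
    (μ : MeasureTheory.Measure X) [MeasureTheory.IsProbabilityMeasure μ]
    [MeasureTheory.NullSingletonClass μ]
    (A : ℕ → Set X) (hA : PEntropy.IsDenseFamily μ A)
    (L : ℕ → ℕ) (hL : Filter.Tendsto L Filter.atTop Filter.atTop) :
    letI := PEntropy.halmosMetric μ hA
    PEntropy.IsTypical
      {S : PEntropy.Aut μ | PEntropy.pEntropy (PEntropy.progression L) S = ⊤} := by
  exact theorem7p1_general μ A hA _ (PEntropy.frequently_isSeparated_progression hL)
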